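/- **Corollary 2.10 (Krichever–Novikov type algebras).** Let $\Bbbk$ be a field of characteristic $0$ and let $C$ be an integral affine curve over $\Bbbk$, possibly singular; that is, its coordinate ring $\Bbbk[C]$ is a finitely generated $\Bbbk$-algebra which is an integral domain of Krull dimension $1$. Let $\mathcal{L}(C) = \operatorname{Der}_{\Bbbk}(\Bbbk[C])$ be the Lie algebra of vector fields on $C$, with the commutator bracket. Let $\mathcal{D}^1(C) = \Bbbk[C] \rtimes \mathcal{L}(C)$, that is, the vector space $\Bbbk[C] \oplus \mathcal{L}(C)$ with bracket $$[(f_1,v_1),(f_2,v_2)] = (v_1(f_2) - v_2(f_1),\,[v_1,v_2]).$$ For a nonzero finite-dimensional Lie algebra $\mathfrak{g}$ over $\Bbbk$, let $\overline{\mathfrak{g}}(C) = \mathfrak{g} \otimes_{\Bbbk} \Bbbk[C]$ be the current algebra, with bracket $[x \otimes f, y \otimes g] = [x,y] \otimes fg$. Then the universal enveloping algebras (over $\Bbbk$) of $\mathcal{L}(C)$, of $\mathcal{D}^1(C)$, and of $\overline{\mathfrak{g}}(C)$ for every such $\mathfrak{g}$, are neither left nor right noetherian. -/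

import Mathlib

open scoped TensorProduct

/-- `IsAffineCurve k A`: the commutative `k`-algebra `A` is the coordinate ring `k[C]` of an
affine curve `C` over the field `k` (integral, possibly singular, not assumed smooth or
geometrically integral), i.e. `A` is a finitely generated `k`-algebra which is a domain of
Krull dimension one. -/
structure IsAffineCurve (k A : Type*) [Field k] [CommRing A] [Algebra k A] : Prop where
  finiteType : Algebra.FiniteType k A
  isDomain : IsDomain A
  ringKrullDim_eq_one : ringKrullDim A = 1

/-- The Krichever-Novikov algebra `𝓛(C) = Der_k(k[C])` of vector fields on `C`, with the
commutator bracket. -/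
abbrev KricheverNovikov (k A : Type*) [Field k] [CommRing A] [Algebra k A] : Type _ :=
  Derivation k A A

/-- The Lie algebra `𝓓¹(C) = k[C] ⋊ 𝓛(C)` of differential operators of degree at most one:
pairs `(f, v)` of a function `f` and a vector field `v`. -/
def DiffOpOne (k A : Type*) [Field k] [CommRing A] [Algebra k A] : Type _ :=
  A × KricheverNovikov k A

namespace DiffOpOne

variable {k A : Type*} [Field k] [CommRing A] [Algebra k A]

instance : AddCommGroup (DiffOpOne k A) :=
  inferInstanceAs (AddCommGroup (A × Derivation k A A))

instance : Module k (DiffOpOne k A) :=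
  inferInstanceAs (Module k (A × Derivation k A A))

/-- `[(f₁, v₁), (f₂, v₂)] = (v₁(f₂) - v₂(f₁), [v₁, v₂])`. -/
instance : Bracket (DiffOpOne k A) (DiffOpOne k A) where
  bracket x y := (x.2 y.1 - y.2 x.1, ⁅x.2, y.2⁆)

theorem lie_fst (x y : DiffOpOne k A) : (⁅x, y⁆).1 = x.2 y.1 - y.2 x.1 := rfl
theorem lie_snd (x y : DiffOpOne k A) : (⁅x, y⁆).2 = ⁅x.2, y.2⁆ := rfl
theorem add_fst (x y : DiffOpOne k A) : (x + y).1 = x.1 + y.1 := rfl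
theorem add_snd (x y : DiffOpOne k A) : (x + y).2 = x.2 + y.2 := rfl
theorem smul_fst (c : k) (x : DiffOpOne k A) : (c • x).1 = c • x.1 := rfl
theorem smul_snd (c : k) (x : DiffOpOne k A) : (c • x).2 = c • x.2 := rfl

instance : LieRing (DiffOpOne k A) where
  add_lie x y z := Prod.ext
    (by simp only [lie_fst, add_fst, add_snd, Derivation.add_apply, map_add]; abel)
    (by simp only [lie_snd, add_snd, add_lie])
  lie_add x y z := Prod.ext
    (by simp only [lie_fst, add_fst, add_snd, Derivation.add_apply, map_add]; abel)
    (by simp only [lie_snd, add_snd, lie_add])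
  lie_self x := Prod.ext (sub_self (x.2 x.1)) (lie_self x.2)
  leibniz_lie x y z := Prod.ext
    (by
      simp only [lie_fst, lie_snd, add_fst, Derivation.commutator_apply, map_sub]
      abel)
    (by simp only [lie_snd, add_snd]; exact leibniz_lie x.2 y.2 z.2)

instance : LieAlgebra k (DiffOpOne k A) where
  lie_smul c x y := Prod.ext
    (by
      simp only [lie_fst, smul_fst, smul_snd, Derivation.smul_apply, smul_sub]
      rw [Derivation.map_smul])
    (lie_smul c x.2 y.2)

end DiffOpOne

/-- The current algebra of a Lie algebra `𝔤` on `C`, i.e. the tensor product over `k` of `𝔤` and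
`k[C]`. Mathlib writes the scalar factor on the left; the bracket is that of
`LieAlgebra.ExtendScalars`, see `CurrentAlgebra.lie_tmul`. -/
abbrev CurrentAlgebra (k A 𝔤 : Type*) [Field k] [CommRing A] [Algebra k A]
    [LieRing 𝔤] [LieAlgebra k 𝔤] : Type _ :=
  A ⊗[k] 𝔤

theorem CurrentAlgebra.lie_tmul {k A 𝔤 : Type*} [Field k] [CommRing A] [Algebra k A]
    [LieRing 𝔤] [LieAlgebra k 𝔤] (f g : A) (x y : 𝔤) :
    (⁅(f ⊗ₜ[k] x : CurrentAlgebra k A 𝔤), (g ⊗ₜ[k] y : CurrentAlgebra k A 𝔤)⁆ :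
      CurrentAlgebra k A 𝔤) = (f * g) ⊗ₜ[k] ⁅x, y⁆ := rfl

/-- The universal enveloping algebra `U(L)` is neither left nor right noetherian.
(`IsNoetherianRing` is left noetherianity; right noetherianity is that of the opposite ring.) -/
def EnvelopingNotNoetherian (k L : Type*) [Field k] [LieRing L] [LieAlgebra k L] : Prop :=
  ¬ IsNoetherianRing (UniversalEnvelopingAlgebra k L) ∧
    ¬ IsNoetherianRing (UniversalEnvelopingAlgebra k L)ᵐᵒᵖ

/-!
The argument avoids the Poincaré–Birkhoff–Witt theorem and finds an infinite-dimensional obstruction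
inside an explicit representation.

Let `L` act on `M` through `ρ`, let `c : L → M` be a 1-cocycle, and let `L` act on `M × k` by
`x (m, t) = (x m + t c(x), 0)`, an extension of the trivial representation by `M`. Let `J ⊆ U(L)` be
the annihilator of `M`. If `J` is generated as a right ideal by `b₁, …, bₙ`, then `J (0, 1)` is the
span of the `bᵢ (0, 1)`: for `r ∈ U(L)` the vector `r (0, 1)` is a scalar multiple of `(0, 1)`
modulo `M`, which `bᵢ` kills. So `U(L)` is not right noetherian as soon as `J (0, 1)` is
infinite-dimensional (`not_isNoetherianRing_op_of_cocycle`). The antipode of `U(L)` exchanges left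
and right.

Write `A = k[C]` and `K = Frac A`. By Noether normalization `A` is integral over some `k[x]`, and
since `K` is formally étale over `k[x]` in characteristic zero, the derivation `∂ = d/dx` lives on
`K` and every `v ∈ Der_k(A)` equals `v(x) ∂` (`exists_derivation_of_isIntegral_aeval`). Clearing the
denominators of `∂` on generators of `A` gives `D = b ∂` in `Der_k(A)` with `b ≠ 0`
(`exists_derivation_integral`).

* For `Der_k(A)` take `M = K` and the divergence cocycle `v ↦ ∂(v(x))`. For `a ∈ A` the element
  `(a x² D)(D) - 2 (a x D)(x D) + (a D)(x² D)` kills `K` and sends `(0, 1)` to `2 b² a`.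
* `k[C] ⋊ Der_k(A)` retracts onto `Der_k(A)`, so its enveloping algebra surjects onto `U(Der_k(A))`.
* For `A ⊗ 𝔤` with `⁅y, z⁆ ≠ 0` take the adjoint representation and the cocycle `D ⊗ id`. The element
  `(a x ⊗ y)(1 ⊗ z) - (a ⊗ y)(x ⊗ z)` kills `A ⊗ 𝔤` and sends `(0, 1)` to `-a D(x) ⊗ ⁅y, z⁆`. If `𝔤`
  is abelian, the zero representation and the identity cocycle do.
-/

/-! ### Cocycles and right ideals of enveloping algebras -/

section Enveloping

open UniversalEnvelopingAlgebra MulOpposite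

attribute [local instance 100] LieRing.ofAssociativeRing

/-- If `R` is right noetherian and every `r n` is a scalar multiple of `n` modulo a subrepresentation
`N₀`, then the annihilator of `N₀` moves `n` inside a finite-dimensional space. -/
theorem exists_finiteDimensional_of_isNoetherianRing_op {k R N : Type*} [Field k] [Ring R]
    [Algebra k R] [AddCommGroup N] [Module k N] [IsNoetherianRing Rᵐᵒᵖ]
    (φ : R →ₐ[k] Module.End k N) (N₀ : Submodule k N) (n : N)
    (hn : ∀ r, ∃ c : k, φ r n - c • n ∈ N₀) (hN₀ : ∀ r, ∀ m ∈ N₀, φ r m ∈ N₀) :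
    ∃ V : Submodule k N, FiniteDimensional k V ∧
      ∀ r, (∀ m ∈ N₀, φ r m = 0) → φ r n ∈ V := by
  let J : Ideal Rᵐᵒᵖ :=
    { carrier := {r | ∀ m ∈ N₀, φ r.unop m = 0}
      add_mem' := fun {a b} ha hb m hm => by simp [ha m hm, hb m hm]
      zero_mem' := fun m _ => by simp
      smul_mem' := fun r s hs m hm => by
        simpa using hs _ (hN₀ r.unop m hm) }
  obtain ⟨S, hS⟩ : J.FG := IsNoetherian.noetherian J
  have hSJ : ∀ s ∈ S, s ∈ J := fun s hs => hS ▸ Submodule.subset_span hs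
  refine ⟨Submodule.span k ((fun s : Rᵐᵒᵖ => φ s.unop n) '' S),
    FiniteDimensional.span_of_finite k (S.finite_toSet.image _), fun r hr => ?_⟩
  have hrJ : op r ∈ Submodule.span Rᵐᵒᵖ (S : Set Rᵐᵒᵖ) := by
    change op r ∈ Ideal.span (S : Set Rᵐᵒᵖ)
    rw [hS]
    exact hr
  rw [← unop_op r]
  generalize op r = r' at hrJ
  induction hrJ using Submodule.closure_induction with
  | zero => simp
  | add a b _ _ ha hb => simpa using add_mem ha hb
  | smul_mem r s hs =>
    obtain ⟨c, hc⟩ := hn r.unop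
    have h0 := hSJ s hs _ hc
    -- The generator `s` kills `r n - c n`, so `s r n = c s n`.
    rw [map_sub, sub_eq_zero, map_smul] at h0
    simp only [smul_eq_mul, unop_mul, map_mul, Module.End.mul_apply, h0]
    exact Submodule.smul_mem _ _ (Submodule.subset_span ⟨s, hs, rfl⟩)

variable {k L M : Type*} [Field k] [LieRing L] [LieAlgebra k L] [AddCommGroup M] [Module k M]

/-- The representation `x (m, t) = (ρ x m + t c(x), 0)` of `L` on `M × k`: the extension of the
trivial representation `k` by `(M, ρ)` that is given by the 1-cocycle `c`. -/
def cocycleExtension (ρ : L →ₗ⁅k⁆ Module.End k M) (c : L →ₗ[k] M)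
    (hc : ∀ x y, c ⁅x, y⁆ = ρ x (c y) - ρ y (c x)) : L →ₗ⁅k⁆ Module.End k (M × k) where
  toFun x := LinearMap.inl k M k ∘ₗ (ρ x).coprod (LinearMap.toSpanSingleton k M (c x))
  map_add' x y := by ext <;> simp
  map_smul' t x := by ext <;> simp
  map_lie' {x y} := by
    ext <;> simp [LieRing.of_associative_ring_bracket, hc]

theorem cocycleExtension_apply (ρ : L →ₗ⁅k⁆ Module.End k M) (c : L →ₗ[k] M)
    (hc : ∀ x y, c ⁅x, y⁆ = ρ x (c y) - ρ y (c x)) (x : L) (p : M × k) :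
    cocycleExtension ρ c hc x p = (ρ x p.1 + p.2 • c x, 0) := rfl

theorem UniversalEnvelopingAlgebra.adjoin_range_ι :
    Algebra.adjoin k (Set.range (ι k : L → UniversalEnvelopingAlgebra k L)) = ⊤ := by
  set S := Algebra.adjoin k (Set.range (ι k : L → UniversalEnvelopingAlgebra k L))
  let f : L →ₗ⁅k⁆ S :=
    { toFun := fun x => ⟨ι k x, Algebra.subset_adjoin ⟨x, rfl⟩⟩
      map_add' := fun x y => Subtype.ext (map_add _ _ _)
      map_smul' := fun t x => Subtype.ext (map_smul _ _ _)
      map_lie' := fun {x y} => Subtype.ext (LieHom.map_lie _ _ _) }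
  have h : S.val.comp (lift k f) = AlgHom.id k _ :=
    hom_ext k (LieHom.ext fun x => congrArg S.val (lift_ι_apply k f x))
  refine eq_top_iff.2 fun u _ => ?_
  have hu : (lift k f u : UniversalEnvelopingAlgebra k L) = u := DFunLike.congr_fun h u
  exact hu ▸ (lift k f u).2

/-- `U(L)` acts on the quotient `k` of `M × k` by scalars, and on the subrepresentation `M` through
`ρ`. -/
theorem lift_cocycleExtension_apply (ρ : L →ₗ⁅k⁆ Module.End k M) (c : L →ₗ[k] M)
    (hc : ∀ x y, c ⁅x, y⁆ = ρ x (c y) - ρ y (c x)) (u : UniversalEnvelopingAlgebra k L) :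
    (∃ t : k, ∀ p, (lift k (cocycleExtension ρ c hc) u p).2 = t * p.2) ∧
      ∀ m, lift k (cocycleExtension ρ c hc) u (m, 0) = (lift k ρ u m, 0) := by
  have hu : u ∈ Algebra.adjoin k (Set.range (ι k : L → UniversalEnvelopingAlgebra k L)) :=
    adjoin_range_ι (k := k) (L := L) ▸ Algebra.mem_top
  induction hu using Algebra.adjoin_induction with
  | mem u hu =>
    obtain ⟨x, rfl⟩ := hu
    simp only [lift_ι_apply, cocycleExtension_apply]
    exact ⟨⟨0, by simp⟩, by simp⟩
  | algebraMap t =>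
    simp only [AlgHom.commutes, Module.algebraMap_end_apply]
    exact ⟨⟨t, fun p => rfl⟩, by simp⟩
  | add u v _ _ hu hv =>
    obtain ⟨⟨s, hs⟩, hu⟩ := hu
    obtain ⟨⟨t, ht⟩, hv⟩ := hv
    exact ⟨⟨s + t, fun p => by simp [hs, ht, add_mul]⟩, fun m => by simp [hu, hv]⟩
  | mul u v _ _ hu hv =>
    obtain ⟨⟨s, hs⟩, hu⟩ := hu
    obtain ⟨⟨t, ht⟩, hv⟩ := hv
    exact ⟨⟨s * t, fun p => by simp [hs, ht, mul_assoc]⟩, fun m => by simp [hu, hv]⟩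

/-- The annihilator of `M` in `U(L)` is not a finitely generated right ideal if it moves the vector
`(0, 1)` of the extension given by `c` through an infinite-dimensional space `j(W)`. -/
theorem not_isNoetherianRing_op_of_cocycle (ρ : L →ₗ⁅k⁆ Module.End k M) (c : L →ₗ[k] M)
    (hc : ∀ x y, c ⁅x, y⁆ = ρ x (c y) - ρ y (c x)) {W : Type*} [AddCommGroup W] [Module k W]
    (hW : ¬ FiniteDimensional k W) (j : W →ₗ[k] M) (hj : Function.Injective j)
    (h : ∀ w, ∃ u, lift k ρ u = 0 ∧ lift k (cocycleExtension ρ c hc) u (0, 1) = (j w, 0)) :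
    ¬ IsNoetherianRing (UniversalEnvelopingAlgebra k L)ᵐᵒᵖ := by
  intro hU
  obtain ⟨V, hV, hu⟩ := exists_finiteDimensional_of_isNoetherianRing_op
    (lift k (cocycleExtension ρ c hc)) (LinearMap.ker (LinearMap.snd k M k)) (0, 1)
    (fun u => by
      obtain ⟨t, ht⟩ := (lift_cocycleExtension_apply ρ c hc u).1
      exact ⟨t, by simp [ht]⟩)
    (fun u m hm => by
      obtain ⟨t, ht⟩ := (lift_cocycleExtension_apply ρ c hc u).1
      simp_all)
  refine hW (FiniteDimensional.of_injective
    (LinearMap.codRestrict V (LinearMap.inl k M k ∘ₗ j) fun w => ?_) ?_)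
  · obtain ⟨u, hu₀, hu₁⟩ := h w
    have := hu u fun m hm => by
      obtain ⟨m, t⟩ := m
      obtain rfl : t = 0 := hm
      simp [(lift_cocycleExtension_apply ρ c hc u).2, hu₀]
    simpa [hu₁] using this
  · intro v w hvw
    simpa [hj.eq_iff] using congrArg Subtype.val hvw

/-- The antipode, `x ↦ -x` on `L`, is an isomorphism of `U(L)` with its opposite ring, so left
noetherian implies right noetherian. -/
theorem isNoetherianRing_op_of_isNoetherianRing_enveloping
    [IsNoetherianRing (UniversalEnvelopingAlgebra k L)] :
    IsNoetherianRing (UniversalEnvelopingAlgebra k L)ᵐᵒᵖ := by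
  let f : L →ₗ⁅k⁆ (UniversalEnvelopingAlgebra k L)ᵐᵒᵖ :=
    { toFun := fun x => op (-ι k x)
      map_add' := fun x y => by rw [map_add, neg_add, op_add]
      map_smul' := fun t x => by rw [map_smul, ← smul_neg, op_smul, RingHom.id_apply]
      map_lie' := fun {x y} => by
        rw [LieHom.map_lie, LieRing.of_associative_ring_bracket,
          LieRing.of_associative_ring_bracket, ← op_mul, ← op_mul, ← op_sub]
        congr 1
        noncomm_ring }
  have h : (AlgHom.opComm (lift k f)).comp (lift k f) = AlgHom.id k _ :=
    hom_ext k (LieHom.ext fun x => by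
      change unop (lift k f (unop (lift k f (ι k x)))) = ι k x
      rw [lift_ι_apply]
      change unop (lift k f (-ι k x)) = _
      rw [map_neg, lift_ι_apply]
      exact neg_neg _)
  refine isNoetherianRing_of_surjective _ _ (lift k f).toRingHom fun u =>
    ⟨unop (lift k f (unop u)), unop_injective (DFunLike.congr_fun h (unop u))⟩

theorem envelopingNotNoetherian_of_op
    (h : ¬ IsNoetherianRing (UniversalEnvelopingAlgebra k L)ᵐᵒᵖ) : EnvelopingNotNoetherian k L :=
  ⟨fun _ => h isNoetherianRing_op_of_isNoetherianRing_enveloping, h⟩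

theorem EnvelopingNotNoetherian.of_retract {L' : Type*} [LieRing L'] [LieAlgebra k L']
    (h : EnvelopingNotNoetherian k L) (f : L' →ₗ⁅k⁆ L) (s : L →ₗ⁅k⁆ L')
    (hfs : ∀ x, f (s x) = x) : EnvelopingNotNoetherian k L' := by
  refine envelopingNotNoetherian_of_op fun _ => h.2 ?_
  let F := lift k ((ι k).comp f)
  let S := lift k ((ι k).comp s)
  have hFS : F.comp S = AlgHom.id k _ := hom_ext k (LieHom.ext fun x => by
    change F (S (ι k x)) = ι k x
    simp only [F, S, lift_ι_apply, LieHom.comp_apply, hfs])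
  exact isNoetherianRing_of_surjective _ _ F.op.toRingHom fun u =>
    ⟨op (S (unop u)), unop_injective (DFunLike.congr_fun hFS (unop u))⟩

/-! ### Derivations of the coordinate ring of an affine curve -/

section Curve

open Polynomial
open scoped KaehlerDifferential

/-- Noether normalization of an affine curve: the coordinate ring is integral over a polynomial
ring in one variable `x`. -/
theorem IsAffineCurve.exists_isIntegral_aeval {k A : Type*} [Field k] [CommRing A] [Algebra k A]
    (hA : IsAffineCurve k A) :
    ∃ x : A, Function.Injective (aeval x : k[X] →ₐ[k] A) ∧
      (aeval x : k[X] →ₐ[k] A).toRingHom.IsIntegral := by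
  have := hA.finiteType
  have := hA.isDomain
  obtain ⟨s, g, hg, hgi⟩ := exists_integral_inj_algHom_of_fg k A
  have hs : s = 1 := by
    -- Lying over bounds `dim k[X₁, …, Xₛ]` by `dim A = 1`; if `s = 0`, then `A` is a field.
    let _ := g.toRingHom.toAlgebra
    have hint : Algebra.IsIntegral (MvPolynomial (Fin s) k) A := ⟨hgi⟩
    have hinj : Function.Injective (algebraMap (MvPolynomial (Fin s) k) A) := hg
    have : Ring.KrullDimLE 1 A := by
      rw [Ring.KrullDimLE, Order.krullDimLE_iff, ← ringKrullDim, hA.ringKrullDim_eq_one]; rfl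
    have h1 : Ring.KrullDimLE 1 (MvPolynomial (Fin s) k) := .mk₁' fun P hP hP' => by
      obtain ⟨Q, hQ, hQP⟩ := Ideal.exists_ideal_over_prime_of_isIntegral_of_isDomain (S := A) P
        (by rw [(RingHom.injective_iff_ker_eq_bot _).1 hinj]; exact bot_le)
      have : Q ≠ ⊥ := by
        rintro rfl
        exact hP (hQP ▸ by
          rw [← RingHom.ker_eq_comap_bot, (RingHom.injective_iff_ker_eq_bot _).1 hinj])
      have := hQ.isMaximal_of_ne_bot this
      exact hQP ▸ Ideal.isMaximal_comap_of_isIntegral_of_isMaximal Q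
    rw [Ring.KrullDimLE, Order.krullDimLE_iff, ← ringKrullDim,
      MvPolynomial.ringKrullDim_of_isNoetherianRing,
      ringKrullDim_eq_zero_of_field, Nat.card_fin, zero_add] at h1
    have h1' : s ≤ 1 := by exact_mod_cast h1
    interval_cases s
    · exfalso
      have hF : IsField A := isField_of_isIntegral_of_isField' (R := MvPolynomial (Fin 0) k)
        ((MvPolynomial.isEmptyAlgEquiv k (Fin 0)).toMulEquiv.isField (Field.toIsField k))
      have := hA.ringKrullDim_eq_one
      rw [ringKrullDim_eq_zero_of_isField hF] at this
      exact zero_ne_one this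
    · rfl
  subst hs
  let e : k[X] ≃ₐ[k] MvPolynomial (Fin 1) k := (MvPolynomial.uniqueAlgEquiv k (Fin 1)).symm
  have he : aeval (g (e X)) = g.comp e.toAlgHom := by ext; simp
  refine ⟨g (e X), ?_, ?_⟩
  · rw [he]; exact hg.comp e.injective
  · rw [he]; exact RingHom.IsIntegral.trans _ _ (RingHom.isIntegral_of_surjective _ e.surjective) hgi

/-- The derivation `d = d/dx` of the function field `K`, where `A` is integral over `k[x]`. It spans
the derivations: every `v ∈ Der_k(A)` is the restriction of `v(x) d`. -/
theorem exists_derivation_of_isIntegral_aeval {k A K : Type*} [Field k] [CharZero k] [CommRing A]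
    [IsDomain A] [Algebra k A] [Field K] [Algebra A K] [Algebra k K] [IsScalarTower k A K]
    [IsFractionRing A K] {x : A} (hx : Function.Injective (aeval x : k[X] →ₐ[k] A))
    (hx' : (aeval x : k[X] →ₐ[k] A).toRingHom.IsIntegral) :
    ∃ d : Derivation k K K, d (algebraMap A K x) = 1 ∧
      ∀ v : Derivation k A A, ∀ a, algebraMap A K (v a) =
        algebraMap A K (v x) * d (algebraMap A K a) := by
  let _ : Algebra k[X] A := (aeval x : k[X] →ₐ[k] A).toAlgebra
  let _ : Algebra k[X] K := ((algebraMap A K).comp (aeval x : k[X] →ₐ[k] A).toRingHom).toAlgebra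
  have : IsScalarTower k[X] A K := .of_algebraMap_eq fun _ => rfl
  have : IsScalarTower k k[X] A := .of_algebraMap_eq fun t => by
    simp [RingHom.algebraMap_toAlgebra]
  have : IsScalarTower k k[X] K := .of_algebraMap_eq fun t => by
    rw [IsScalarTower.algebraMap_apply k[X] A K, ← IsScalarTower.algebraMap_apply k k[X] A,
      ← IsScalarTower.algebraMap_apply k A K]
  have hinj : Function.Injective (algebraMap k[X] K) := (IsFractionRing.injective A K).comp hx
  have : FaithfulSMul k[X] K := (faithfulSMul_iff_algebraMap_injective _ _).2 hinj
  have : FaithfulSMul k[X] A := (faithfulSMul_iff_algebraMap_injective _ _).2 hx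
  have : Algebra.IsIntegral k[X] A := ⟨hx'⟩
  let _ : Algebra (FractionRing k[X]) K := FractionRing.liftAlgebra k[X] K
  have : Algebra.IsAlgebraic (FractionRing k[X]) K :=
    (IsFractionRing.comap_isAlgebraic_iff (A := k[X])).1
      ((IsFractionRing.isAlgebraic_iff' k[X] A K).1 inferInstance)
  have : CharZero (FractionRing k[X]) := algebraRat.charZero _
  have : Algebra.FormallyEtale (FractionRing k[X]) K := .of_isSeparable _ _
  have : Algebra.FormallyEtale k[X] (FractionRing k[X]) :=
    .of_isLocalization (nonZeroDivisors k[X])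
  have : Algebra.FormallyEtale k[X] K := .comp _ (FractionRing k[X]) _
  have : Algebra.FormallyEtale A K := .of_isLocalization (nonZeroDivisors A)
  have hX : algebraMap k[X] A X = x := aeval_X x
  have hX' : algebraMap k[X] K X = algebraMap A K x := by
    rw [IsScalarTower.algebraMap_apply k[X] A K, hX]
  have hbX := KaehlerDifferential.isBaseChange_of_formallyEtale k k[X] K
  have hbA := KaehlerDifferential.isBaseChange_of_formallyEtale k A K
  -- `Ω[K⁄k]` is the base change to `K` of `Ω[k[X]⁄k]`, which is free on `dX`, and also of `Ω[A⁄k]`.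
  let ℓ : Ω[K⁄k] →ₗ[K] K := hbX.lift
    ((Algebra.linearMap k[X] K).comp (KaehlerDifferential.polynomialEquiv k).toLinearMap)
  let d : Derivation k K K := ℓ.compDer (KaehlerDifferential.D k K)
  have hd : d (algebraMap A K x) = 1 := by
    have h := hbX.lift_eq ((Algebra.linearMap k[X] K).comp
      (KaehlerDifferential.polynomialEquiv k).toLinearMap) (KaehlerDifferential.D k k[X] X)
    rw [KaehlerDifferential.map_D, hX'] at h
    refine Eq.trans ?_ (h.trans ?_)
    · rfl
    · simp
  refine ⟨d, hd, fun v a => ?_⟩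
  let m : Ω[A⁄k] →ₗ[A] K := (Algebra.linearMap A K).comp v.liftKaehlerDifferential
  have hm : ∀ b, hbA.lift m (KaehlerDifferential.D k K (algebraMap A K b)) =
      algebraMap A K (v b) := fun b => by
    have h := hbA.lift_eq m (KaehlerDifferential.D k A b)
    rw [KaehlerDifferential.map_D] at h
    simpa [m] using h
  have hℓ : hbA.lift m = algebraMap A K (v x) • ℓ := by
    refine hbX.algHom_ext _ _ fun ω => ?_
    obtain ⟨p, rfl⟩ := (KaehlerDifferential.polynomialEquiv k).symm.surjective ω
    rw [KaehlerDifferential.polynomialEquiv_symm, map_smul, KaehlerDifferential.map_D,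
      ← algebraMap_smul K p, map_smul, map_smul, hX', hm, LinearMap.smul_apply]
    change _ = _ • _ • d _
    rw [hd, smul_eq_mul (_ : K) 1, mul_one]
  rw [← hm, hℓ]
  rfl

/-- Some nonzero multiple of a derivation of the function field preserves the coordinate ring: it
suffices to clear the denominators at finitely many generators. -/
theorem exists_derivation_integral {k A K : Type*} [Field k] [CommRing A]
    [IsDomain A] [Algebra k A] [Algebra.FiniteType k A] [Field K] [Algebra A K] [Algebra k K]
    [IsScalarTower k A K] [IsFractionRing A K] (d : Derivation k K K) :
    ∃ (b : A) (D : Derivation k A A), b ≠ 0 ∧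
      ∀ a, algebraMap A K (D a) = algebraMap A K b * d (algebraMap A K a) := by
  obtain ⟨S, hS⟩ := ‹Algebra.FiniteType k A›.out
  classical
  obtain ⟨b, hb⟩ := IsLocalization.exist_integer_multiples_of_finset (nonZeroDivisors A)
    (S.image fun a => d (algebraMap A K a))
  have hmem : ∀ a, (b : A) • d (algebraMap A K a) ∈ LinearMap.range (Algebra.linearMap A K) := by
    intro a
    have ha : a ∈ Algebra.adjoin k (S : Set A) := hS ▸ Algebra.mem_top
    induction ha using Algebra.adjoin_induction with
    | mem a ha => exact hb _ (Finset.mem_image_of_mem _ ha)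
    | algebraMap t =>
      rw [← IsScalarTower.algebraMap_apply, d.map_algebraMap, smul_zero]
      exact zero_mem _
    | add a a' _ _ h h' =>
      rw [map_add, map_add, smul_add]; exact add_mem h h'
    | mul a a' _ _ h h' =>
      rw [map_mul, d.leibniz, smul_add, algebraMap_smul, algebraMap_smul, smul_comm,
        smul_comm (b : A) a']
      exact add_mem (Submodule.smul_mem _ _ h') (Submodule.smul_mem _ _ h)
  choose D hD using hmem
  have hinj := IsFractionRing.injective A K
  have hD' : ∀ a, algebraMap A K (D a) = algebraMap A K b * d (algebraMap A K a) := fun a => by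
    rw [← Algebra.smul_def]; exact hD a
  refine ⟨b, Derivation.mk' { toFun := D, map_add' := fun a a' => hinj ?_,
                              map_smul' := fun t a => hinj ?_ } fun a a' => hinj ?_,
    nonZeroDivisors.coe_ne_zero b, hD'⟩
  · simp [hD', mul_add]
  · simp only [hD', Algebra.smul_def, map_mul, ← IsScalarTower.algebraMap_apply, RingHom.id_apply,
      d.leibniz, d.map_algebraMap]
    simp; ring
  · simp [hD']; ring

theorem not_finiteDimensional_of_isAffineCurve {k A : Type*} [Field k] [CommRing A] [Algebra k A]
    (hA : IsAffineCurve k A) : ¬ FiniteDimensional k A := by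
  intro h
  obtain ⟨x, hx, -⟩ := hA.exists_isIntegral_aeval
  exact Polynomial.not_finite (R := k) (Module.Finite.of_injective (aeval x).toLinearMap hx)

end Curve

/-! ### Vector fields, differential operators and current algebras -/

theorem envelopingNotNoetherian_kricheverNovikov {k A : Type*} [Field k] [CharZero k] [CommRing A]
    [Algebra k A] (hA : IsAffineCurve k A) :
    EnvelopingNotNoetherian k (KricheverNovikov k A) := by
  have := hA.finiteType
  have := hA.isDomain
  obtain ⟨x, hx, hx'⟩ := hA.exists_isIntegral_aeval
  let K := FractionRing A
  obtain ⟨d, hdx, hd⟩ := exists_derivation_of_isIntegral_aeval (A := A) (K := K) hx hx'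
  obtain ⟨b, D, hb, hD⟩ := exists_derivation_integral (A := A) d
  let j := algebraMap A K
  have hj : Function.Injective j := IsFractionRing.injective A K
  -- The action of `v = v(x) d` on `K`, and its divergence.
  let ρ : Derivation k A A →ₗ⁅k⁆ Module.End k K :=
    { toFun := fun v => LinearMap.mulLeft k (j (v x)) ∘ₗ d
      map_add' := fun v w => by ext h; simp [add_mul]
      map_smul' := fun t v => by
        ext h
        simp [Algebra.smul_def, ← IsScalarTower.algebraMap_apply, j]
      map_lie' := fun {v w} => by
        ext h
        simp only [LieRing.of_associative_ring_bracket, LinearMap.comp_apply, LinearMap.sub_apply,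
          Module.End.mul_apply, LinearMap.mulLeft_apply, Derivation.coeFn_coe,
          Derivation.commutator_apply, map_sub, d.leibniz, smul_eq_mul, j, hd v (w x), hd w (v x)]
        ring }
  let c : Derivation k A A →ₗ[k] K :=
    { toFun := fun v => d (j (v x))
      map_add' := fun v w => by simp
      map_smul' := fun t v => by
        rw [Derivation.smul_apply, ← d.map_smul, RingHom.id_apply, Algebra.smul_def,
          Algebra.smul_def, map_mul, ← IsScalarTower.algebraMap_apply] }
  have hρ : ∀ v h, ρ v h = j (v x) * d h := fun _ _ => rfl
  have hc : ∀ v, c v = d (j (v x)) := fun _ => rfl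
  have hcoc : ∀ v w, c ⁅v, w⁆ = ρ v (c w) - ρ w (c v) := fun v w => by
    simp only [hc, hρ, Derivation.commutator_apply, map_sub, d.leibniz, smul_eq_mul, j,
      hd v (w x), hd w (v x)]
    ring
  have hDx : ∀ f : A, j ((f • D) x) = j f * j b := fun f => by
    rw [Derivation.smul_apply, smul_eq_mul, map_mul, hD, hdx, mul_one]
  have hdx' : d (j x) = 1 := hdx
  have hb' : j b ≠ 0 := fun h => hb (hj (h.trans (map_zero j).symm))
  have h2 : (2 : K) ≠ 0 := by
    have : CharZero K := charZero_of_injective_algebraMap (algebraMap k K).injective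
    exact two_ne_zero
  -- With `f ⊗ g` in `a x² ⊗ 1 - 2 a x ⊗ x + a ⊗ x²`, the sums of `f g` and of `f g'` vanish, so
  -- `∑ (f D)(g D)` acts by zero on `K`; the sum of `f g''` is `2 a`, hence the value `2 b² a`.
  refine envelopingNotNoetherian_of_op (not_isNoetherianRing_op_of_cocycle ρ c hcoc
    (not_finiteDimensional_of_isAffineCurve hA)
    (LinearMap.mulLeft k (2 * j b ^ 2) ∘ₗ (IsScalarTower.toAlgHom k A K).toLinearMap)
    (fun f g hfg => hj (mul_left_cancel₀ (mul_ne_zero h2 (pow_ne_zero 2 hb')) hfg)) fun a =>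
    ⟨ι k ((a * (x * x)) • D) * ι k ((1 : A) • D) - ι k ((a * x + a * x) • D) * ι k (x • D) +
      ι k (a • D) * ι k ((x * x) • D), ?_, ?_⟩)
  · ext h
    simp only [map_sub, map_add, map_mul, lift_ι_apply, LinearMap.add_apply,
      LinearMap.sub_apply, Module.End.mul_apply, hρ, hDx, d.leibniz, map_one, hdx',
      d.map_one_eq_zero, smul_eq_mul, LinearMap.zero_apply]
    ring
  · simp only [map_sub, map_add, map_mul, lift_ι_apply, LinearMap.add_apply,
      LinearMap.sub_apply, Module.End.mul_apply, hρ, hDx, hc, d.leibniz, map_one, hdx',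
      d.map_one_eq_zero, smul_eq_mul, cocycleExtension_apply, map_zero, LinearMap.comp_apply,
      LinearMap.mulLeft_apply]
    refine Prod.ext ?_ (by simp)
    change _ = 2 * j b ^ 2 * j a
    simp [hdx']
    ring

theorem envelopingNotNoetherian_diffOpOne {k A : Type*} [Field k] [CharZero k] [CommRing A]
    [Algebra k A] (hA : IsAffineCurve k A) : EnvelopingNotNoetherian k (DiffOpOne k A) :=
  (envelopingNotNoetherian_kricheverNovikov hA).of_retract
    { toFun := fun p => p.2
      map_add' := fun _ _ => rfl
      map_smul' := fun _ _ => rfl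
      map_lie' := rfl }
    { toFun := fun v => ((0, v) : A × Derivation k A A)
      map_add' := fun v w => Prod.ext (add_zero 0).symm rfl
      map_smul' := fun t v => Prod.ext (smul_zero t).symm rfl
      map_lie' := fun {v w} => Prod.ext (by
        change (0 : A) = v 0 - w 0
        rw [map_zero, map_zero, sub_zero]) rfl }
    fun _ => rfl

theorem envelopingNotNoetherian_currentAlgebra {k A : Type*} [Field k] [CharZero k] [CommRing A]
    [Algebra k A] (hA : IsAffineCurve k A) (𝔤 : Type*) [LieRing 𝔤] [LieAlgebra k 𝔤]
    [Nontrivial 𝔤] : EnvelopingNotNoetherian k (CurrentAlgebra k A 𝔤) := by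
  have hfin := not_finiteDimensional_of_isAffineCurve hA
  have hinj : ∀ y : 𝔤, y ≠ 0 → Function.Injective ((TensorProduct.mk k A 𝔤).flip y) := by
    intro y hy
    have := Module.Flat.lTensor_preserves_injective_linearMap (M := A)
      (LinearMap.toSpanSingleton k 𝔤 y) (smul_left_injective k hy)
    intro f g hfg
    simpa using (this.comp (TensorProduct.rid k A).symm.injective) (a₁ := f) (a₂ := g)
      (by simpa using hfg)
  refine envelopingNotNoetherian_of_op ?_
  by_cases hab : ∀ y z : 𝔤, ⁅y, z⁆ = 0
  · obtain ⟨y, hy⟩ := exists_ne (0 : 𝔤)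
    refine not_isNoetherianRing_op_of_cocycle (k := k) (M := A ⊗[k] 𝔤) 0 LinearMap.id ?_ hfin _
      (hinj y hy) fun a => ⟨ι k (a ⊗ₜ y), ?_, ?_⟩
    · intro X Y
      simp only [LinearMap.id_apply, LieHom.zero_apply, LinearMap.zero_apply, sub_zero]
      induction X using TensorProduct.induction_on with
      | zero => simp
      | add X X' h h' => rw [add_lie, h, h', add_zero]
      | tmul f x =>
        induction Y using TensorProduct.induction_on with
        | zero => simp
        | add X X' h h' => rw [lie_add, h, h', add_zero]
        | tmul g y => rw [CurrentAlgebra.lie_tmul, hab, TensorProduct.tmul_zero]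
    · rw [lift_ι_apply, LieHom.zero_apply]
    · rw [lift_ι_apply, cocycleExtension_apply]; simp
  · push Not at hab
    obtain ⟨y, z, hyz⟩ := hab
    have := hA.finiteType
    have := hA.isDomain
    obtain ⟨x, hx, hx'⟩ := hA.exists_isIntegral_aeval
    obtain ⟨d, hdx, -⟩ := exists_derivation_of_isIntegral_aeval (K := FractionRing A) hx hx'
    obtain ⟨b, D, hb, hD⟩ := exists_derivation_integral (A := A) d
    have hDx : D x ≠ 0 := fun h => hb (IsFractionRing.injective A (FractionRing A) (by
      rw [map_zero, ← mul_one (algebraMap A _ b), ← hdx, ← hD, h, map_zero]))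
    refine not_isNoetherianRing_op_of_cocycle (k := k) (M := A ⊗[k] 𝔤)
      (LieModule.toEnd k (A ⊗[k] 𝔤) (A ⊗[k] 𝔤)) (D.toLinearMap.rTensor 𝔤) ?_ hfin
      ((TensorProduct.mk k A 𝔤).flip ⁅y, z⁆ ∘ₗ LinearMap.mulRight k (-D x))
      ((hinj _ hyz).comp (mul_left_injective₀ (neg_ne_zero.2 hDx))) fun a =>
        ⟨ι k ((a * x) ⊗ₜ y) * ι k (1 ⊗ₜ z) - ι k (a ⊗ₜ y) * ι k (x ⊗ₜ z), ?_, ?_⟩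
    · intro X Y
      simp only [LieModule.toEnd_apply_apply]
      induction X using TensorProduct.induction_on with
      | zero => simp
      | add X X' h h' => simp only [add_lie, map_add, lie_add, h, h']; abel
      | tmul f x =>
        induction Y using TensorProduct.induction_on with
        | zero => simp
        | add X X' h h' => simp only [add_lie, map_add, lie_add, h, h']; abel
        | tmul g y =>
          simp only [CurrentAlgebra.lie_tmul, LinearMap.rTensor_tmul, Derivation.coeFn_coe,
            D.leibniz, smul_eq_mul, TensorProduct.add_tmul]
          rw [← lie_skew y x, TensorProduct.tmul_neg, sub_neg_eq_add]
    · ext f w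
      simp only [map_sub, map_mul, lift_ι_apply]
      simp [mul_assoc]
    · simp only [map_sub, map_mul, lift_ι_apply]
      simp [cocycleExtension_apply]

end Enveloping

theorem corollary2p10 {k A : Type*} [Field k] [CharZero k] [CommRing A] [Algebra k A]
    (hA : IsAffineCurve k A) :
    EnvelopingNotNoetherian k (KricheverNovikov k A) ∧
    EnvelopingNotNoetherian k (DiffOpOne k A) ∧
    (∀ (𝔤 : Type*) [LieRing 𝔤] [LieAlgebra k 𝔤] [FiniteDimensional k 𝔤] [Nontrivial 𝔤],
      EnvelopingNotNoetherian k (CurrentAlgebra k A 𝔤)) :=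
  ⟨envelopingNotNoetherian_kricheverNovikov hA, envelopingNotNoetherian_diffOpOne hA,
    fun 𝔤 => envelopingNotNoetherian_currentAlgebra hA 𝔤⟩
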